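/- Fix an integer $N\ge 3$ and real numbers $0<p<1$, $0<q\le 1$, $0\le r\le 1$, and put $h=(1-p)q$. The $N$-interactions model is the following random evolution of a weighted graph. For a finite nonempty set $A$ of vertices, the weight of $A$ counts the interactions in which all vertices of $A$ took part (the initial configuration counting as one interaction); a set of $m$ vertices of positive weight is called an (existing) $m$-clique. At time $0$ there is a single set of $N$ vertices, and this $N$-clique and all its sub-cliques have weight $1$. At each time step $n=1,2,\dots$ a set of $N$ vertices interacts, i.e. the weights of this set and of all its nonempty subsets are increased by $1$. Given the past, the interacting set is chosen as follows. - With probability $p$ a new vertex is added, and it interacts with $N-1$ old vertices. With probability $r$ these are the vertices of an existing $(N-1)$-clique chosen with probability proportional to its weight; with probability $1-r$ they form a uniformly chosen $(N-1)$-element set of old vertices. - With probability $1-p$ no vertex is added, and $N$ old vertices interact. With probability $q$ these are the vertices of an existing $N$-clique chosen with probability proportional to its weight; with probability $1-q$ they form a uniformly chosen $N$-element set of old vertices. Let $K(n,w)$ be the number of $N$-cliques of weight $w$ after $n$ steps. **Theorem.** There are non-negative numbers $k_w$, $w=1,2,\dots$, satisfying $$k_1=\frac{1-h}{h+1},\qquad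 k_w=\frac{(w-1)h}{wh+1}\,k_{w-1}\quad (w>1),$$ such that for every fixed $w\ge 1$ $$\frac{K(n,w)}{n}\longrightarrow k_w\qquad\text{almost surely as } n\to\infty .$$ -/

import Mathlib

open MeasureTheory Filter Topology
open scoped ENNReal

namespace NInteractions

/-- The sub-cliques of a clique `A`: all its nonempty sets of vertices, `A` included. -/
def subCliques (A : Finset ℕ) : Finset (Finset ℕ) := A.powerset.erase ∅

/-- The weight increment caused by an interaction of the vertices in `A`: `A` and each of its
sub-cliques gain weight one. -/
noncomputable def increment (A : Finset ℕ) : Finset ℕ →₀ ℕ :=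
  ∑ B ∈ subCliques A, Finsupp.single B 1

theorem increment_ne_zero {A B : Finset ℕ} (hB : B ∈ subCliques A) : increment A B ≠ 0 := by
  classical
  simp only [increment, Finsupp.finsetSum_apply, Finsupp.single_apply]
  simp [hB]

/-- The evolving weighted structure. The existing vertices are `0, …, order - 1` and `weight A` is
the weight of the vertex set `A`; the existing `m`-cliques are the `m`-element sets of
positive weight (vertices for `m = 1`, edges for `m = 2`), and weight zero means
that the vertices of `A` have never interacted together. The two last fields make the random
choices below well defined; they persist under interactions. -/
structure State (N : ℕ) where
  order : ℕ
  weight : Finset ℕ →₀ ℕ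
  le_order : N ≤ order
  exists_clique : ∀ m, 1 ≤ m → m ≤ N → ∃ A : Finset ℕ, A.card = m ∧ weight A ≠ 0

instance (N : ℕ) : MeasurableSpace (State N) := ⊤

/-- Time zero: one `N`-clique, all of whose sub-cliques (and itself) have weight one. -/
noncomputable def initialState (N : ℕ) : State N where
  order := N
  weight := increment (Finset.range N)
  le_order := le_rfl
  exists_clique := fun m h1 hm => ⟨Finset.range m, Finset.card_range m, increment_ne_zero (by
    simp only [subCliques, Finset.mem_erase, Finset.mem_powerset]
    exact ⟨by simp; omega, Finset.range_mono hm⟩)⟩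

namespace State

variable {N : ℕ}

/-- Interaction of the set `A` of old vertices. -/
noncomputable def interactOld (G : State N) (A : Finset ℕ) : State N where
  order := G.order
  weight := G.weight + increment A
  le_order := G.le_order
  exists_clique := fun m h1 hm => by
    obtain ⟨B, hB, hw⟩ := G.exists_clique m h1 hm
    exact ⟨B, hB, by simp [hw]⟩

/-- A new vertex, labelled `G.order`, is added and interacts with the old vertices in `A`. -/
noncomputable def interactNew (G : State N) (A : Finset ℕ) : State N where
  order := G.order + 1
  weight := G.weight + increment (insert G.order A)
  le_order := G.le_order.trans (Nat.le_succ _)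
  exists_clique := fun m h1 hm => by
    obtain ⟨B, hB, hw⟩ := G.exists_clique m h1 hm
    exact ⟨B, hB, by simp [hw]⟩

/-- The weight of `A` if `A` has `m` elements, and zero otherwise. -/
noncomputable def cliqueWeight (G : State N) (m : ℕ) (A : Finset ℕ) : ℝ≥0∞ :=
  if A.card = m then (G.weight A : ℝ≥0∞) else 0

theorem tsum_cliqueWeight_ne_zero (G : State N) {m : ℕ} (h1 : 1 ≤ m) (hm : m ≤ N) :
    ∑' A, G.cliqueWeight m A ≠ 0 := by
  obtain ⟨A, hA, hw⟩ := G.exists_clique m h1 hm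
  intro h
  have := ENNReal.tsum_eq_zero.1 h A
  simp [cliqueWeight, hA, hw] at this

theorem tsum_cliqueWeight_ne_top (G : State N) (m : ℕ) : ∑' A, G.cliqueWeight m A ≠ ∞ := by
  rw [tsum_eq_sum (s := G.weight.support)]
  · refine ENNReal.sum_ne_top.2 fun A _ => ?_
    unfold cliqueWeight
    split_ifs <;> simp
  · intro A hA
    simp [cliqueWeight, Finsupp.notMem_support_iff.1 hA]

/-- Preferential attachment: an existing `m`-clique is chosen with probability proportional to
its weight. -/
noncomputable def preferential (G : State N) (m : ℕ) (h1 : 1 ≤ m) (hm : m ≤ N) :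
    PMF (Finset ℕ) :=
  PMF.normalize (G.cliqueWeight m) (G.tsum_cliqueWeight_ne_zero h1 hm)
    (G.tsum_cliqueWeight_ne_top m)

/-- Uniform choice among all `m`-element sets of existing vertices. -/
noncomputable def uniform (G : State N) (m : ℕ) (hm : m ≤ N) : PMF (Finset ℕ) :=
  PMF.uniformOfFinset (Finset.powersetCard m (Finset.range G.order))
    (Finset.powersetCard_nonempty.2 (by simpa using hm.trans G.le_order))

/-- The number of existing `N`-cliques of weight `w` (for `w ≥ 1`). -/
def cliqueCount (G : State N) (w : ℕ) : ℕ :=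
  (G.weight.support.filter fun A => A.card = N ∧ G.weight A = w).card

end State

/-- With probability `a` draw from `P`, with probability `1 - a` draw from `Q`. -/
noncomputable def mixture {α : Type*} (a : unitInterval) (P Q : PMF α) : PMF α :=
  ⟨fun x => ENNReal.ofReal (a : ℝ) * P x + ENNReal.ofReal (1 - (a : ℝ)) * Q x, by
    rw [ENNReal.summable.hasSum_iff, ENNReal.tsum_add, ENNReal.tsum_mul_left,
      ENNReal.tsum_mul_left, P.tsum_coe, Q.tsum_coe, mul_one, mul_one,
      ← ENNReal.ofReal_add a.2.1 (sub_nonneg.2 a.2.2)]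
    simp⟩

/-- One step of the evolution. With probability `p` a new vertex interacts with `N - 1` old
vertices, chosen preferentially with probability `r` and uniformly with probability `1 - r`;
with probability `1 - p`, `N` old vertices interact, chosen preferentially with probability `q`
and uniformly with probability `1 - q`. -/
noncomputable def step {N : ℕ} (hN : 3 ≤ N) (p q r : unitInterval) (G : State N) :
    PMF (State N) :=
  mixture p
    ((mixture r (G.preferential (N - 1) (by omega) (by omega))
      (G.uniform (N - 1) (by omega))).map G.interactNew)
    ((mixture q (G.preferential N (by omega) le_rfl) (G.uniform N le_rfl)).map G.interactOld)

/-- `G` is a realisation of the `N`-interactions model with parameters `p, q, r`: it starts from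
one `N`-clique, and given the whole past the next state is distributed according to `step`. -/
structure IsNInteractionsProcess {N : ℕ} (hN : 3 ≤ N) (p q r : unitInterval)
    {Ω : Type*} [MeasurableSpace Ω] (μ : Measure Ω) (G : ℕ → Ω → State N) : Prop where
  measurable : ∀ n, Measurable (G n)
  initial : ∀ᵐ ω ∂μ, G 0 ω = initialState N
  transition : ∀ (n : ℕ) (g : ℕ → State N) (s : State N),
    μ ({ω | ∀ i ≤ n, G i ω = g i} ∩ {ω | G (n + 1) ω = s}) =
      μ {ω | ∀ i ≤ n, G i ω = g i} * step hN p q r (g n) s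

end NInteractions

namespace NInteractions

/-! An `N`-set has only itself as an `N`-element subset, so one interaction changes the weight of
exactly one `N`-set (`cliqueSum_add_increment`). Hence the `N`-cliques have total weight `n + 1`
after `n` steps, and a preferential choice hits weight `v` with probability `v K(n,v) / (n+1)`. A
new vertex always produces an `N`-clique of weight one, so `r` plays no role. A uniform choice
almost always does the same: at most `n + 1` of the `N`-sets have positive weight, while the number
of vertices is of order `p n`, so that there are at least of order `n ^ 2` sets
(`WellFormed.abs_uniformDrift_sub_le`, `tendsto_div_choose`).

The conditional mean of `K(n+1,w) - K(n,w)` is therefore `β n - h w K(n,w) / (n+1)`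
(`WellFormed.expect_cliqueCount_increment`), where `β n` tends to `1 - h` if `w = 1` and to `h (w-1)
k_{w-1}` if `w > 1`, by induction on `w`. The centred increments are bounded and orthogonal, so
their averages vanish almost surely (`IsChain.ae_tendsto_average_innovation`). What remains is a
deterministic recursion (`tendsto_div_of_recursion`), whose only possible slope solves `c = b - h w
c`. -/

/-! ### Strong law for bounded orthogonal variables -/

theorem abs_sum_range_le {u : ℕ → ℝ} {C : ℝ} (h : ∀ i, |u i| ≤ C) (n : ℕ) :
    |∑ i ∈ Finset.range n, u i| ≤ C * n := by
  refine (Finset.abs_sum_le_sum_abs _ _).trans ((Finset.sum_le_sum fun i _ => h i).trans ?_)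
  simp [mul_comm]

/-- Averages of a bounded sequence converge to zero as soon as they do along the squares. -/
theorem tendsto_average_of_tendsto_squares {u : ℕ → ℝ} {C : ℝ} (hC : ∀ i, |u i| ≤ C)
    (h : Tendsto (fun k : ℕ => (∑ i ∈ Finset.range ((k + 1) ^ 2), u i) / (((k + 1) ^ 2 : ℕ) : ℝ))
      atTop (𝓝 0)) :
    Tendsto (fun n : ℕ => (∑ i ∈ Finset.range n, u i) / n) atTop (𝓝 0) := by
  -- Adding `C * n` makes the partial sums monotone, so convergence along a subsequence whose
  -- consecutive ratios tend to one suffices.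
  have key : Tendsto (fun n : ℕ => (∑ i ∈ Finset.range n, u i + C * n) / n) atTop (𝓝 C) := by
    refine tendsto_div_of_monotone_of_exists_subseq_tendsto_div _ _ ?_ ?_
    · refine monotone_nat_of_le_succ fun n => ?_
      rw [Finset.sum_range_succ]
      push_cast
      linarith [neg_abs_le (u n), hC n]
    · intro a ha
      refine ⟨fun k => (k + 1) ^ 2, ?_, ?_, ?_⟩
      · have h1 : Tendsto (fun n : ℕ => (1 + 1 / ((n : ℝ) + 1)) ^ 2) atTop (𝓝 ((1 + 0) ^ 2)) :=
          (tendsto_const_nhds.add tendsto_one_div_add_atTop_nhds_zero_nat).pow 2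
        filter_upwards [h1.eventually_lt_const (u := a) (by simpa using ha)] with n hn
        have hpos : (0 : ℝ) < (n : ℝ) + 1 := by positivity
        have : (((n + 1 + 1) ^ 2 : ℕ) : ℝ) = (1 + 1 / ((n : ℝ) + 1)) ^ 2 * (((n + 1) ^ 2 : ℕ) : ℝ) := by
          push_cast; field_simp
        rw [this]
        exact mul_le_mul_of_nonneg_right hn.le (by positivity)
      · refine tendsto_atTop_mono (fun k => ?_) tendsto_id
        simp only [id]; nlinarith
      · have h2 := h.add (tendsto_const_nhds (x := C))
        rw [zero_add] at h2
        refine h2.congr fun k => ?_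
        have : (((k + 1) ^ 2 : ℕ) : ℝ) ≠ 0 := by positivity
        field_simp
  have h3 := key.sub (tendsto_const_nhds (x := C))
  rw [sub_self] at h3
  refine h3.congr' ?_
  filter_upwards [eventually_ne_atTop 0] with n hn
  have : (n : ℝ) ≠ 0 := by exact_mod_cast hn
  field_simp
  ring

section Orthogonal

variable {Ω : Type*} [MeasurableSpace Ω] {μ : Measure Ω} [IsProbabilityMeasure μ]
  {ξ : ℕ → Ω → ℝ} {C : ℝ}

theorem integrable_of_abs_le {f : Ω → ℝ} (hf : Measurable f) {C : ℝ} (hC : ∀ ω, |f ω| ≤ C) :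
    Integrable f μ :=
  Integrable.of_bound hf.aestronglyMeasurable C (ae_of_all _ fun ω => by simpa using hC ω)

/-- Orthogonality removes the cross terms. The linear growth makes the second moments of the
averages summable along the squares. -/
theorem integral_sq_sum_le (hm : ∀ i, Measurable (ξ i)) (hC : ∀ i ω, |ξ i ω| ≤ C)
    (ho : ∀ i j, i < j → ∫ ω, ξ i ω * ξ j ω ∂μ = 0) (n : ℕ) :
    ∫ ω, (∑ i ∈ Finset.range n, ξ i ω) ^ 2 ∂μ ≤ C ^ 2 * n := by
  have hprod : ∀ i j, Integrable (fun ω => ξ i ω * ξ j ω) μ := fun i j =>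
    integrable_of_abs_le ((hm i).mul (hm j)) (C := C * C) fun ω => by
      rw [abs_mul]
      exact mul_le_mul (hC i ω) (hC j ω) (abs_nonneg _) ((abs_nonneg _).trans (hC i ω))
  induction n with
  | zero => simp
  | succ n ih =>
    have hS : Measurable fun ω => ∑ i ∈ Finset.range n, ξ i ω :=
      Finset.measurable_sum _ fun i _ => hm i
    have hcross : ∫ ω, ∑ i ∈ Finset.range n, 2 * (ξ i ω * ξ n ω) ∂μ = 0 := by
      rw [integral_finsetSum _ fun i _ => (hprod i n).const_mul 2]
      refine Finset.sum_eq_zero fun i hi => ?_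
      rw [integral_const_mul, ho i n (Finset.mem_range.1 hi), mul_zero]
    have hsq : ∫ ω, ξ n ω * ξ n ω ∂μ ≤ C ^ 2 := by
      have := integral_mono (hprod n n) (integrable_const (μ := μ) (C ^ 2)) fun ω => by
        have := sq_le_sq' (neg_le_of_abs_le (hC n ω)) (le_of_abs_le (hC n ω))
        simpa [sq] using this
      simpa using this
    have hSi : Integrable (fun ω => (∑ i ∈ Finset.range n, ξ i ω) ^ 2) μ :=
      integrable_of_abs_le (hS.pow_const 2) (C := (C * n) ^ 2) fun ω => by
        rw [abs_pow]
        exact pow_le_pow_left₀ (abs_nonneg _) (abs_sum_range_le (fun i => hC i ω) n) 2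
    have hexp : ∀ ω, (∑ i ∈ Finset.range (n + 1), ξ i ω) ^ 2 =
        (∑ i ∈ Finset.range n, ξ i ω) ^ 2 + ∑ i ∈ Finset.range n, 2 * (ξ i ω * ξ n ω)
          + ξ n ω * ξ n ω := fun ω => by
      rw [Finset.sum_range_succ, ← Finset.mul_sum, ← Finset.sum_mul]; ring
    have hci : Integrable (fun ω => ∑ i ∈ Finset.range n, 2 * (ξ i ω * ξ n ω)) μ :=
      integrable_finsetSum _ fun i _ => (hprod i n).const_mul 2
    rw [integral_congr_ae (ae_of_all _ hexp), integral_add (by exact hSi.add hci) (hprod n n),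
      integral_add hSi hci, hcross]
    push_cast
    linarith

/-- Strong law of large numbers for uniformly bounded orthogonal random variables. -/
theorem ae_tendsto_average_of_orthogonal (hm : ∀ i, Measurable (ξ i))
    (hC : ∀ i ω, |ξ i ω| ≤ C) (ho : ∀ i j, i < j → ∫ ω, ξ i ω * ξ j ω ∂μ = 0) :
    ∀ᵐ ω ∂μ, Tendsto (fun n : ℕ => (∑ i ∈ Finset.range n, ξ i ω) / n) atTop (𝓝 0) := by
  set F : ℕ → Ω → ℝ := fun k ω =>
    ((∑ i ∈ Finset.range ((k + 1) ^ 2), ξ i ω) / (((k + 1) ^ 2 : ℕ) : ℝ)) ^ 2 with hF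
  have hFm : ∀ k, Measurable (F k) := fun k =>
    ((Finset.measurable_sum _ fun i _ => hm i).div_const _).pow_const 2
  have hFi : ∀ k, Integrable (F k) μ := fun k =>
    integrable_of_abs_le (hFm k) (C := C ^ 2) fun ω => by
      rw [hF, abs_pow, abs_div, Nat.abs_cast]
      refine pow_le_pow_left₀ (by positivity) ?_ 2
      rw [div_le_iff₀ (by positivity)]
      exact abs_sum_range_le (fun i => hC i ω) _
  have hint : ∀ k, ∫ ω, F k ω ∂μ ≤ C ^ 2 * (1 / ((k + 1 : ℕ) : ℝ) ^ 2) := fun k => by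
    simp only [hF, div_pow]
    rw [integral_div, div_le_iff₀ (by positivity)]
    refine (integral_sq_sum_le hm hC ho _).trans (le_of_eq ?_)
    push_cast
    field_simp
  have hsum : Summable fun k : ℕ => C ^ 2 * (1 / ((k + 1 : ℕ) : ℝ) ^ 2) :=
    ((summable_nat_add_iff 1).2 (Real.summable_one_div_nat_pow.2 one_lt_two)).mul_left _
  -- A series of non-negative variables with finite expectation converges almost surely, so its
  -- terms tend to zero; this replaces Borel–Cantelli.
  have hlt : ∫⁻ ω, ∑' k, ENNReal.ofReal (F k ω) ∂μ ≠ ∞ := by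
    rw [lintegral_tsum fun k => (hFm k).ennreal_ofReal.aemeasurable]
    refine ne_top_of_le_ne_top hsum.tsum_ofReal_ne_top (ENNReal.tsum_le_tsum fun k => ?_)
    rw [← ofReal_integral_eq_lintegral_ofReal (hFi k) (ae_of_all _ fun ω => sq_nonneg _)]
    exact ENNReal.ofReal_le_ofReal (hint k)
  filter_upwards [ae_lt_top (Measurable.tsum fun k => (hFm k).ennreal_ofReal) hlt] with ω hω
  refine tendsto_average_of_tendsto_squares (fun i => hC i ω) ?_
  have h0 := (ENNReal.tendsto_toReal ENNReal.zero_ne_top).comp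
    (ENNReal.tendsto_atTop_zero_of_tsum_ne_top hω.ne)
  have h1 : Tendsto (fun k => F k ω) atTop (𝓝 0) := by
    refine h0.congr fun k => ?_
    simp [hF, sq_nonneg, ENNReal.toReal_ofReal]
  rw [tendsto_zero_iff_abs_tendsto_zero]
  have h2 := h1.sqrt
  rw [Real.sqrt_zero] at h2
  refine h2.congr fun k => ?_
  simp only [hF, Real.sqrt_sq_eq_abs, Function.comp]

end Orthogonal

/-! ### Perturbed linear recursions -/

/-- A perturbed linear recursion with asymptotically negligible noise `S`. -/
theorem tendsto_div_of_recursion {X S β : ℕ → ℝ} {a b : ℝ} (ha : 0 ≤ a)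
    (hβ : Tendsto β atTop (𝓝 b)) (hS : Tendsto (fun n : ℕ => S n / n) atTop (𝓝 0))
    (hX : ∀ n, X (n + 1) - X n = β n - a * (X n / (n + 1)) + (S (n + 1) - S n)) :
    Tendsto (fun n : ℕ => X n / n) atTop (𝓝 (b / (1 + a))) := by
  set c := b / (1 + a) with hc
  have ha' : 1 + a ≠ 0 := by positivity
  have hbc : b = c * (1 + a) := by rw [hc]; field_simp
  -- Remove the noise and the trend. Since `b = c * (1 + a)`, the constant drift cancels and only an
  -- error `ε n → 0` is left.
  set Z : ℕ → ℝ := fun n => X n - S n - c * n with hZ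
  set ε : ℕ → ℝ := fun n => (β n - b) - a * (S n / (n + 1)) + a * c * (1 / ((n : ℝ) + 1)) with hε
  have hS' : Tendsto (fun n : ℕ => S n / ((n : ℝ) + 1)) atTop (𝓝 0) := by
    have := hS.mul (tendsto_natCast_div_add_atTop (1 : ℝ))
    rw [zero_mul] at this
    refine this.congr' ?_
    filter_upwards [eventually_ne_atTop 0] with n hn
    have : (n : ℝ) ≠ 0 := by exact_mod_cast hn
    field_simp
  have hε0 : Tendsto ε atTop (𝓝 0) := by
    have := ((hβ.sub_const b).sub (hS'.const_mul a)).add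
      ((tendsto_one_div_add_atTop_nhds_zero_nat (𝕜 := ℝ)).const_mul (a * c))
    simpa [hε] using this
  have hrec : ∀ n, Z (n + 1) = Z n * (1 - a / (n + 1)) + ε n := fun n => by
    have h1 : (n : ℝ) + 1 ≠ 0 := by positivity
    have h2 : X (n + 1) = X n + β n - a * (X n / (n + 1)) + (S (n + 1) - S n) := by
      linarith [hX n]
    simp only [hZ, hε, h2, hbc]
    push_cast
    field_simp
    ring
  -- From index `m ≥ a` on, the multiplier `1 - a / (n + 1)` lies in `[0, 1]`, so `|Z|` grows by at
  -- most `|ε n|` per step and Cesàro averaging applies.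
  obtain ⟨m, hm⟩ := exists_nat_ge a
  have hbound : ∀ k, |Z (m + k)| ≤ |Z m| + ∑ i ∈ Finset.range (m + k), |ε i| := by
    intro k
    induction k with
    | zero => simpa using Finset.sum_nonneg fun i _ => abs_nonneg (ε i)
    | succ k ih =>
      rw [← add_assoc, hrec, Finset.sum_range_succ]
      have hle : a / (((m + k : ℕ) : ℝ) + 1) ≤ 1 := by
        rw [div_le_one (by positivity)]
        push_cast
        linarith [(Nat.cast_nonneg k : (0 : ℝ) ≤ k)]
      have hge : 0 ≤ a / (((m + k : ℕ) : ℝ) + 1) := by positivity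
      have h3 : |Z (m + k) * (1 - a / (((m + k : ℕ) : ℝ) + 1))| ≤ |Z (m + k)| := by
        rw [abs_mul]
        refine mul_le_of_le_one_right (abs_nonneg _) ?_
        rw [abs_le]; constructor <;> linarith
      linarith [abs_add_le (Z (m + k) * (1 - a / (((m + k : ℕ) : ℝ) + 1))) (ε (m + k))]
  have hZ0 : Tendsto (fun n : ℕ => Z n / n) atTop (𝓝 0) := by
    have h4 : Tendsto (fun n : ℕ => |Z m| / (n : ℝ) + (n⁻¹ : ℝ) * ∑ i ∈ Finset.range n, |ε i|)
        atTop (𝓝 0) := by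
      have h5 : Tendsto (fun n => |ε n|) atTop (𝓝 0) := by simpa using hε0.abs
      simpa using (tendsto_const_div_atTop_nhds_zero_nat |Z m|).add h5.cesaro
    refine squeeze_zero_norm' ?_ h4
    filter_upwards [eventually_ge_atTop m] with n hn
    obtain ⟨k, rfl⟩ := Nat.exists_eq_add_of_le hn
    rw [Real.norm_eq_abs, abs_div, Nat.abs_cast, ← div_eq_inv_mul, ← add_div]
    exact div_le_div_of_nonneg_right (hbound k) (by positivity)
  have := (hZ0.add hS).add_const c
  rw [zero_add, zero_add] at this
  refine this.congr' ?_
  filter_upwards [eventually_ne_atTop 0] with n hn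
  have : (n : ℝ) ≠ 0 := by exact_mod_cast hn
  simp only [hZ]
  field_simp
  ring

/-! ### Expectations under discrete distributions -/

section Expect

variable {α β : Type*}

/-- The expectation of `F` under the discrete distribution `P`. -/
noncomputable def expect (P : PMF α) (F : α → ℝ) : ℝ := ∑' x, (P x).toReal * F x

theorem summable_toReal (P : PMF α) : Summable fun x => (P x).toReal :=
  ENNReal.summable_toReal P.tsum_coe_ne_top

theorem tsum_toReal (P : PMF α) : ∑' x, (P x).toReal = 1 := by
  rw [← ENNReal.tsum_toReal_eq fun x => P.apply_ne_top x, P.tsum_coe, ENNReal.toReal_one]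

theorem summable_expect (P : PMF α) {F : α → ℝ} {C : ℝ} (hF : ∀ x, |F x| ≤ C) :
    Summable fun x => (P x).toReal * F x := by
  refine Summable.of_norm_bounded ((summable_toReal P).mul_right C) fun x => ?_
  rw [norm_mul, Real.norm_eq_abs, Real.norm_eq_abs, abs_of_nonneg ENNReal.toReal_nonneg]
  exact mul_le_mul_of_nonneg_left (hF x) ENNReal.toReal_nonneg

theorem expect_congr {P : PMF α} {F F' : α → ℝ} (h : ∀ x ∈ P.support, F x = F' x) :
    expect P F = expect P F' := by
  refine tsum_congr fun x => ?_
  by_cases hx : P x = 0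
  · simp [hx]
  · rw [h x ((P.mem_support_iff x).2 hx)]

theorem expect_const (P : PMF α) (c : ℝ) : expect P (fun _ => c) = c := by
  rw [expect, tsum_mul_right, tsum_toReal, one_mul]

theorem abs_expect_le (P : PMF α) {F : α → ℝ} {C : ℝ} (hF : ∀ x, |F x| ≤ C) :
    |expect P F| ≤ C := by
  have hs := summable_expect P hF
  have hs' := summable_expect P (F := fun _ => C) (C := |C|) fun _ => le_rfl
  have hC := expect_const P C
  rw [abs_le]
  constructor
  · rw [← expect_const P (-C)]
    refine Summable.tsum_le_tsum (fun x => ?_)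
      (summable_expect P (F := fun _ => -C) (C := |-C|) fun _ => le_rfl) hs
    exact mul_le_mul_of_nonneg_left (neg_le_of_abs_le (hF x)) ENNReal.toReal_nonneg
  · rw [← hC]
    refine Summable.tsum_le_tsum (fun x => ?_) hs hs'
    exact mul_le_mul_of_nonneg_left (le_of_abs_le (hF x)) ENNReal.toReal_nonneg

theorem expect_mixture (a : unitInterval) (P Q : PMF α) {F : α → ℝ} {C : ℝ}
    (hF : ∀ x, |F x| ≤ C) :
    expect (mixture a P Q) F = a * expect P F + (1 - a) * expect Q F := by
  rw [expect, expect, expect, ← tsum_mul_left, ← tsum_mul_left,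
    ← ((summable_expect P hF).mul_left _).tsum_add ((summable_expect Q hF).mul_left _)]
  refine tsum_congr fun x => ?_
  have h : mixture a P Q x = ENNReal.ofReal (a : ℝ) * P x + ENNReal.ofReal (1 - (a : ℝ)) * Q x :=
    rfl
  rw [h, ENNReal.toReal_add (ENNReal.mul_ne_top ENNReal.ofReal_ne_top (P.apply_ne_top x))
    (ENNReal.mul_ne_top ENNReal.ofReal_ne_top (Q.apply_ne_top x)), ENNReal.toReal_mul,
    ENNReal.toReal_mul, ENNReal.toReal_ofReal a.2.1, ENNReal.toReal_ofReal (sub_nonneg.2 a.2.2)]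
  ring

theorem integral_toMeasure [MeasurableSpace α] [DiscreteMeasurableSpace α] (P : PMF α)
    {F : α → ℝ} {C : ℝ} (hF : ∀ x, |F x| ≤ C) : ∫ x, F x ∂P.toMeasure = expect P F := by
  rw [PMF.integral_eq_tsum P F (integrable_of_abs_le .of_discrete hF)]
  rfl

theorem expect_map (P : PMF α) (f : α → β) {F : β → ℝ} {C : ℝ} (hF : ∀ x, |F x| ≤ C) :
    expect (P.map f) F = expect P (F ∘ f) := by
  -- With discrete σ-algebras everything is measurable, and the change of variables for integrals
  -- gives the claim.
  let _ : MeasurableSpace α := ⊤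
  let _ : MeasurableSpace β := ⊤
  have h := integral_toMeasure P (F := F ∘ f) fun x => hF (f x)
  rw [← integral_toMeasure _ hF, ← h,
    ← PMF.toMeasure_map f P .of_discrete,
    integral_map Measurable.of_discrete.aemeasurable Measurable.of_discrete.aestronglyMeasurable]
  rfl

end Expect

/-! ### Markov chains on a countable state space -/

section Chain

variable {S Ω : Type*} [MeasurableSpace S] [Countable S] [MeasurableSingletonClass S]
  [MeasurableSpace Ω]

/-- The path of `X` up to time `n`. -/
def history (X : ℕ → Ω → S) (n : ℕ) (ω : Ω) : Fin (n + 1) → S := fun i => X i ω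

theorem measurable_history {S Ω : Type*} [MeasurableSpace S] [MeasurableSpace Ω] {X : ℕ → Ω → S}
    (hX : ∀ n, Measurable (X n)) (n : ℕ) : Measurable (history X n) :=
  measurable_pi_lambda _ fun i => hX i

/-- `X` is a Markov chain with transition probabilities `κ`. -/
structure IsChain (κ : S → PMF S) (μ : Measure Ω) (X : ℕ → Ω → S) : Prop where
  measurable : ∀ n, Measurable (X n)
  transition : ∀ (n : ℕ) (g : ℕ → S) (s : S),
    μ ({ω | ∀ i ≤ n, X i ω = g i} ∩ {ω | X (n + 1) ω = s}) =
      μ {ω | ∀ i ≤ n, X i ω = g i} * κ (g n) s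

/-- The conditional law of the next state given the path up to time `n`. -/
noncomputable def historyKernel (κ : S → PMF S) (n : ℕ) :
    ProbabilityTheory.Kernel (Fin (n + 1) → S) S :=
  ⟨fun h => (κ (h (Fin.last n))).toMeasure, .of_discrete⟩

instance (κ : S → PMF S) (n : ℕ) : ProbabilityTheory.IsMarkovKernel (historyKernel κ n) :=
  ⟨fun h => inferInstanceAs (IsProbabilityMeasure (κ (h (Fin.last n))).toMeasure)⟩

namespace IsChain

variable {κ : S → PMF S} {μ : Measure Ω} [IsProbabilityMeasure μ] {X : ℕ → Ω → S}

/-- Finite paths form a countable space, so singletons decide equality of the two laws; there it is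
the transition identity. -/
theorem map_history_next (hX : IsChain κ μ X) (n : ℕ) :
    μ.map (fun ω => (history X n ω, X (n + 1) ω)) =
      (μ.map (history X n)).compProd (historyKernel κ n) := by
  refine Measure.ext_of_singleton fun ⟨h, s⟩ => ?_
  -- The values of `g` beyond `n` are arbitrary; only times up to `n` enter.
  set g : ℕ → S := fun i => if hi : i < n + 1 then h ⟨i, hi⟩ else h 0
  have hgi : ∀ i (hi : i ≤ n), g i = h ⟨i, Nat.lt_succ_of_le hi⟩ := fun i hi =>
    dif_pos (Nat.lt_succ_of_le hi)
  have hev : ∀ ω, (∀ i ≤ n, X i ω = g i) ↔ history X n ω = h := fun ω => by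
    constructor
    · intro H
      funext i
      exact (H i (Nat.lt_succ_iff.1 i.2)).trans (hgi i (Nat.lt_succ_iff.1 i.2))
    · rintro rfl i hi
      exact (hgi i hi).symm
  have hgn : g n = h (Fin.last n) := hgi n le_rfl
  have htr := hX.transition n g s
  simp only [hev, hgn] at htr
  rw [Measure.map_apply ((measurable_history hX.measurable n).prodMk (hX.measurable _)) (.of_discrete),
    Measure.compProd_apply (.of_discrete), lintegral_countable', tsum_eq_single h]
  · have h1 : (fun ω => (history X n ω, X (n + 1) ω)) ⁻¹' {(h, s)} =
        {ω | history X n ω = h} ∩ {ω | X (n + 1) ω = s} := by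
      ext ω; simp
    have h2 : Prod.mk h ⁻¹' {(h, s)} = {s} := by ext t; simp
    rw [h1, h2, htr, Measure.map_apply (measurable_history hX.measurable n) (.of_discrete), mul_comm]
    congr 1
    exact (PMF.toMeasure_apply_singleton _ _ (.of_discrete)).symm
  · intro h' hne
    have h2 : Prod.mk h' ⁻¹' {(h, s)} = ∅ := by ext t; simp [hne]
    rw [h2, measure_empty, zero_mul]

/-- Almost surely, every transition has positive probability. -/
theorem ae_transition_ne_zero (hX : IsChain κ μ X) :
    ∀ᵐ ω ∂μ, ∀ n, κ (X n ω) (X (n + 1) ω) ≠ 0 := by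
  refine ae_all_iff.2 fun n => ?_
  have h1 : ∀ᵐ z ∂(μ.map (history X n)).compProd (historyKernel κ n),
      κ (z.1 (Fin.last n)) z.2 ≠ 0 := by
    refine (Measure.ae_compProd_iff (.of_discrete)).2 (ae_of_all _ fun h => ?_)
    rw [ae_iff]
    refine ((κ (h (Fin.last n))).toMeasure_apply_eq_zero_iff (.of_discrete)).2 ?_
    rw [Set.disjoint_left]
    intro x hx hx'
    simp only [Set.mem_ofPred_eq, not_not] at hx'
    exact (PMF.mem_support_iff _ _).1 hx hx'
  rw [← hX.map_history_next n] at h1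
  exact ae_of_ae_map ((measurable_history hX.measurable n).prodMk (hX.measurable _)).aemeasurable h1

/-- For each fixed path the inner integral of the innovation is zero: a martingale difference is
orthogonal to every bounded function of the past. -/
theorem integral_mul_innovation (hX : IsChain κ μ X) (n : ℕ) {φ : (Fin (n + 1) → S) → ℝ}
    {F : S → S → ℝ} {B C : ℝ} (hφ : ∀ h, |φ h| ≤ B) (hF : ∀ s t, |F s t| ≤ C) :
    ∫ ω, φ (history X n ω) *
      (F (X n ω) (X (n + 1) ω) - expect (κ (X n ω)) (F (X n ω))) ∂μ = 0 := by
  have hbd : ∀ s t, |F s t - expect (κ s) (F s)| ≤ C + C := fun s t =>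
    (abs_sub _ _).trans (add_le_add (hF s t) (abs_expect_le _ (hF s)))
  set Ψ : (Fin (n + 1) → S) × S → ℝ := fun z =>
    φ z.1 * (F (z.1 (Fin.last n)) z.2 - expect (κ (z.1 (Fin.last n))) (F (z.1 (Fin.last n))))
    with hΨ
  have hprob : IsProbabilityMeasure (μ.map (history X n)) :=
    Measure.isProbabilityMeasure_map (measurable_history hX.measurable n).aemeasurable
  have h1 : ∫ ω, Ψ (history X n ω, X (n + 1) ω) ∂μ = 0 := by
    rw [← integral_map (f := Ψ)
      ((measurable_history hX.measurable n).prodMk (hX.measurable _)).aemeasurable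
      Measurable.of_discrete.aestronglyMeasurable, hX.map_history_next n, Measure.integral_compProd]
    · refine integral_eq_zero_of_ae (ae_of_all _ fun h => ?_)
      simp only [hΨ]
      rw [integral_const_mul]
      refine mul_eq_zero_of_right _ ?_
      change ∫ t, _ ∂(κ (h (Fin.last n))).toMeasure = 0
      rw [integral_sub (integrable_of_abs_le .of_discrete (hF _)) (integrable_const _),
        integral_toMeasure _ (hF _)]
      simp
    · refine integrable_of_abs_le .of_discrete (C := B * (C + C)) fun z => ?_
      rw [hΨ, abs_mul]
      exact mul_le_mul (hφ _) (hbd _ _) (abs_nonneg _) ((abs_nonneg _).trans (hφ z.1))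
  exact h1

/-- Along a Markov chain, the average of bounded increments minus their conditional
expectations tends to zero. -/
theorem ae_tendsto_average_innovation (hX : IsChain κ μ X) {F : S → S → ℝ} {C : ℝ}
    (hF : ∀ s t, |F s t| ≤ C) :
    ∀ᵐ ω ∂μ, Tendsto (fun n : ℕ => (∑ i ∈ Finset.range n,
      (F (X i ω) (X (i + 1) ω) - expect (κ (X i ω)) (F (X i ω)))) / n) atTop (𝓝 0) := by
  have hbd : ∀ s t, |F s t - expect (κ s) (F s)| ≤ C + C := fun s t =>
    (abs_sub _ _).trans (add_le_add (hF s t) (abs_expect_le _ (hF s)))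
  refine ae_tendsto_average_of_orthogonal (C := C + C) (fun i => ?_) (fun i ω => hbd _ _) ?_
  · have : Measurable fun z : S × S => F z.1 z.2 - expect (κ z.1) (F z.1) := .of_discrete
    exact this.comp ((hX.measurable i).prodMk (hX.measurable (i + 1)))
  · intro i j hij
    -- The `i`-th innovation is a function of the path up to time `j`, because `i + 1 ≤ j`.
    exact hX.integral_mul_innovation j
      (φ := fun h => F (h ⟨i, by omega⟩) (h ⟨i + 1, by omega⟩)
        - expect (κ (h ⟨i, by omega⟩)) (F (h ⟨i, by omega⟩))) (fun h => hbd _ _) hF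

end IsChain

end Chain

/-! ### Effect of one interaction on the `N`-cliques -/

variable {N : ℕ}

instance : DiscreteMeasurableSpace (State N) := ⟨fun _ => trivial⟩

instance : Countable (State N) := by
  have hinj : Function.Injective fun G : State N => (G.order, G.weight) := by
    rintro ⟨a, b, c, d⟩ ⟨a', b', c', d'⟩ h
    obtain ⟨rfl, rfl⟩ := Prod.mk.inj h
    rfl
  exact hinj.countable

theorem increment_apply (A B : Finset ℕ) :
    increment A B = if B ∈ subCliques A then 1 else 0 := by
  classical
  simp only [increment, Finsupp.finsetSum_apply, Finsupp.single_apply]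
  simp

theorem mem_subCliques_iff_eq {A B : Finset ℕ} (hN : 1 ≤ N) (hA : A.card = N) (hB : B.card = N) :
    B ∈ subCliques A ↔ B = A := by
  simp only [subCliques, Finset.mem_erase, Finset.mem_powerset]
  constructor
  · rintro ⟨-, h⟩
    exact Finset.eq_of_subset_of_card_le h (by omega)
  · rintro rfl
    refine ⟨?_, subset_rfl⟩
    rintro rfl
    simp at hA
    omega

/-- The cliques with `N` vertices. -/
noncomputable def nCliques (N : ℕ) (W : Finset ℕ →₀ ℕ) : Finset (Finset ℕ) :=
  W.support.filter fun A => A.card = N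

/-- The sum of a function of the weight over all `N`-cliques. -/
noncomputable def cliqueSum (N : ℕ) (W : Finset ℕ →₀ ℕ) (φ : ℕ → ℝ) : ℝ :=
  ∑ A ∈ nCliques N W, φ (W A)

/-- Since `φ 0 = 0`, the index set may be enlarged; the sums before and after an interaction can
then be compared over a common set. -/
theorem cliqueSum_eq_of_subset (W : Finset ℕ →₀ ℕ) {φ : ℕ → ℝ} (h0 : φ 0 = 0)
    {T : Finset (Finset ℕ)} (hT : W.support ⊆ T) :
    cliqueSum N W φ = ∑ A ∈ T.filter fun A => A.card = N, φ (W A) := by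
  refine Finset.sum_subset (Finset.filter_subset_filter _ hT) fun A hA hA' => ?_
  simp only [nCliques, Finset.mem_filter, not_and] at hA hA'
  by_cases h : W A = 0
  · rw [h, h0]
  · exact absurd hA.2 (hA' (Finsupp.mem_support_iff.2 h))

/-- Among the `N`-sets only `A` itself gains weight. Taking `φ` to be the identity controls the
total weight, and an indicator gives the clique counts. -/
theorem cliqueSum_add_increment (hN : 1 ≤ N) (W : Finset ℕ →₀ ℕ) {A : Finset ℕ}
    (hA : A.card = N) {φ : ℕ → ℝ} (h0 : φ 0 = 0) :
    cliqueSum N (W + increment A) φ = cliqueSum N W φ + (φ (W A + 1) - φ (W A)) := by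
  classical
  set T : Finset (Finset ℕ) := insert A (W.support ∪ (W + increment A).support)
  have h1 : W.support ⊆ T := fun B hB => by simp [T, Finsupp.mem_support_iff.1 hB]
  have h2 : (W + increment A).support ⊆ T := fun B hB =>
    Finset.mem_insert_of_mem (Finset.mem_union_right _ hB)
  have hAT : A ∈ T.filter fun B => B.card = N := by simp [T, hA]
  rw [cliqueSum_eq_of_subset W h0 h1, cliqueSum_eq_of_subset _ h0 h2,
    ← Finset.add_sum_erase _ _ hAT, ← Finset.add_sum_erase _ _ hAT]
  have h3 : (W + increment A) A = W A + 1 := by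
    rw [Finsupp.add_apply, increment_apply, if_pos ((mem_subCliques_iff_eq hN hA hA).2 rfl)]
  rw [h3, Finset.sum_congr rfl fun B hB => ?_]
  · ring
  · have hB' := Finset.mem_erase.1 hB
    rw [Finsupp.add_apply, increment_apply, if_neg, add_zero]
    rw [mem_subCliques_iff_eq hN hA (Finset.mem_filter.1 hB'.2).2]
    exact hB'.1

theorem cliqueCount_eq_cliqueSum (G : State N) (w : ℕ) :
    (G.cliqueCount w : ℝ) = cliqueSum N G.weight fun v => if v = w then 1 else 0 := by
  rw [State.cliqueCount, cliqueSum, nCliques, ← Finset.filter_filter, Finset.card_filter]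
  push_cast
  rfl

theorem cliqueSum_mul_indicator (G : State N) (w : ℕ) :
    cliqueSum N G.weight (fun v => (v : ℝ) * if v = w then 1 else 0) = w * G.cliqueCount w := by
  rw [cliqueCount_eq_cliqueSum, cliqueSum, cliqueSum, Finset.mul_sum]
  refine Finset.sum_congr rfl fun A _ => ?_
  split_ifs with h
  · rw [h]
  · simp

/-- The properties shared by all states that can be reached after `n` interactions. -/
structure WellFormed (n : ℕ) (G : State N) : Prop where
  subset_range : ∀ A ∈ G.weight.support, A ⊆ Finset.range G.order
  total : cliqueSum N G.weight (fun v => (v : ℝ)) = n + 1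

theorem mem_of_mem_support_add_increment {W : Finset ℕ →₀ ℕ} {A B : Finset ℕ}
    (h : B ∈ (W + increment A).support) : B ∈ W.support ∨ B ⊆ A := by
  by_cases hB : B ∈ subCliques A
  · exact Or.inr (Finset.mem_powerset.1 (Finset.mem_of_mem_erase hB))
  · left
    rw [Finsupp.mem_support_iff, Finsupp.add_apply, increment_apply, if_neg hB, add_zero] at h
    exact Finsupp.mem_support_iff.2 h

theorem wellFormed_initialState (hN : 1 ≤ N) : WellFormed 0 (initialState N) := by
  have h0 : (initialState N).weight = 0 + increment (Finset.range N) := (zero_add _).symm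
  refine ⟨fun B hB => ?_, ?_⟩
  · rw [h0] at hB
    rcases mem_of_mem_support_add_increment hB with h | h
    · simp at h
    · exact h
  · rw [h0, cliqueSum_add_increment hN 0 (Finset.card_range N) Nat.cast_zero]
    simp [cliqueSum, nCliques]

theorem card_insert_order {G : State N} (hN : 1 ≤ N) {A : Finset ℕ} (hA : A.card = N - 1)
    (hs : A ⊆ Finset.range G.order) : (insert G.order A).card = N := by
  rw [Finset.card_insert_of_notMem fun h => by simpa using hs h, hA]
  omega

/-- The label `G.order` is fresh, so it lies in no set of positive weight. -/
theorem WellFormed.weight_insert_order {n : ℕ} {G : State N} (hG : WellFormed n G)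
    (A : Finset ℕ) : G.weight (insert G.order A) = 0 := by
  by_contra h
  simpa using hG.subset_range _ (Finsupp.mem_support_iff.2 h) (Finset.mem_insert_self _ _)

theorem WellFormed.interactOld {n : ℕ} {G : State N} (hG : WellFormed n G) (hN : 1 ≤ N)
    {A : Finset ℕ} (hA : A.card = N) (hs : A ⊆ Finset.range G.order) :
    WellFormed (n + 1) (G.interactOld A) := by
  refine ⟨fun B hB => ?_, ?_⟩
  · rcases mem_of_mem_support_add_increment hB with h | h
    · exact hG.subset_range B h
    · exact h.trans hs
  · rw [State.interactOld, cliqueSum_add_increment hN _ hA Nat.cast_zero, hG.total]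
    push_cast
    ring

theorem WellFormed.interactNew {n : ℕ} {G : State N} (hG : WellFormed n G) (hN : 1 ≤ N)
    {A : Finset ℕ} (hA : A.card = N - 1) (hs : A ⊆ Finset.range G.order) :
    WellFormed (n + 1) (G.interactNew A) := by
  have hsub : Finset.range G.order ⊆ Finset.range (G.order + 1) :=
    Finset.range_mono (Nat.le_succ _)
  refine ⟨fun B hB => ?_, ?_⟩
  · rcases mem_of_mem_support_add_increment hB with h | h
    · exact (hG.subset_range B h).trans hsub
    · exact h.trans (Finset.insert_subset (by simp [State.interactNew]) (hs.trans hsub))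
  · rw [State.interactNew, cliqueSum_add_increment hN _ (card_insert_order hN hA hs)
      Nat.cast_zero, hG.total]
    push_cast
    ring

/-! ### Reachable transitions -/

theorem mem_support_mixture {α : Type*} {a : unitInterval} {P Q : PMF α} {x : α}
    (h : x ∈ (mixture a P Q).support) : x ∈ P.support ∨ x ∈ Q.support := by
  by_contra! hx
  rw [PMF.mem_support_iff, PMF.mem_support_iff, not_not, not_not] at hx
  refine (PMF.mem_support_iff _ _).1 h ?_
  change ENNReal.ofReal (a : ℝ) * P x + ENNReal.ofReal (1 - (a : ℝ)) * Q x = 0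
  rw [hx.1, hx.2, mul_zero, mul_zero, add_zero]

theorem WellFormed.of_mem_support_preferential {n : ℕ} {G : State N} (hG : WellFormed n G)
    {m : ℕ} {h1 : 1 ≤ m} {hm : m ≤ N} {A : Finset ℕ} (hA : A ∈ (G.preferential m h1 hm).support) :
    A.card = m ∧ A ⊆ Finset.range G.order := by
  rw [State.preferential, PMF.mem_support_normalize_iff, State.cliqueWeight] at hA
  split_ifs at hA with hc
  · exact ⟨hc, hG.subset_range A (Finsupp.mem_support_iff.2 (by exact_mod_cast hA))⟩
  · exact absurd rfl hA

theorem of_mem_support_uniform {G : State N} {m : ℕ} {hm : m ≤ N} {A : Finset ℕ}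
    (hA : A ∈ (G.uniform m hm).support) : A.card = m ∧ A ⊆ Finset.range G.order := by
  rw [State.uniform, PMF.mem_support_uniformOfFinset_iff, Finset.mem_powersetCard] at hA
  exact hA.symm

theorem WellFormed.of_mem_support_choice {n : ℕ} {G : State N} (hG : WellFormed n G)
    {a : unitInterval} {m : ℕ} {h1 : 1 ≤ m} {hm : m ≤ N} {A : Finset ℕ}
    (hA : A ∈ (mixture a (G.preferential m h1 hm) (G.uniform m hm)).support) :
    A.card = m ∧ A ⊆ Finset.range G.order :=
  (mem_support_mixture hA).elim hG.of_mem_support_preferential of_mem_support_uniform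

theorem WellFormed.of_mem_support_step {n : ℕ} {G s : State N} (hG : WellFormed n G)
    {hN : 3 ≤ N} {p q r : unitInterval} (hs : s ∈ (step hN p q r G).support) :
    (∃ A, (A.card = N - 1 ∧ A ⊆ Finset.range G.order) ∧ s = G.interactNew A) ∨
      ∃ A, (A.card = N ∧ A ⊆ Finset.range G.order) ∧ s = G.interactOld A := by
  rcases mem_support_mixture hs with h | h
  · obtain ⟨A, hA, rfl⟩ := (PMF.mem_support_map_iff _ _ _).1 h
    exact Or.inl ⟨A, hG.of_mem_support_choice hA, rfl⟩
  · obtain ⟨A, hA, rfl⟩ := (PMF.mem_support_map_iff _ _ _).1 h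
    exact Or.inr ⟨A, hG.of_mem_support_choice hA, rfl⟩

theorem WellFormed.next {n : ℕ} {G s : State N} (hG : WellFormed n G)
    {hN : 3 ≤ N} {p q r : unitInterval} (hs : s ∈ (step hN p q r G).support) :
    WellFormed (n + 1) s := by
  obtain ⟨A, hA, rfl⟩ | ⟨A, hA, rfl⟩ := hG.of_mem_support_step hs
  · exact hG.interactNew (by omega) hA.1 hA.2
  · exact hG.interactOld (by omega) hA.1 hA.2

/-! ### Conditional expectations of one step -/

theorem WellFormed.expect_preferential {n : ℕ} {G : State N} (hG : WellFormed n G)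
    (h1 : 1 ≤ N) (g : Finset ℕ → ℝ) :
    expect (G.preferential N h1 le_rfl) g =
      (∑ A ∈ nCliques N G.weight, (G.weight A : ℝ) * g A) / (n + 1) := by
  have hzero : ∀ A ∉ nCliques N G.weight, G.cliqueWeight N A = 0 := fun A hA => by
    rw [State.cliqueWeight]
    split_ifs with hc
    · have : G.weight A = 0 := by
        by_contra h
        exact hA (Finset.mem_filter.2 ⟨Finsupp.mem_support_iff.2 h, hc⟩)
      rw [this, Nat.cast_zero]
    · rfl
  have hval : ∀ A ∈ nCliques N G.weight, G.cliqueWeight N A = (G.weight A : ℝ≥0∞) := fun A hA =>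
    if_pos (Finset.mem_filter.1 hA).2
  have htot : (∑' A, G.cliqueWeight N A).toReal = n + 1 := by
    rw [tsum_eq_sum hzero, Finset.sum_congr rfl hval, ← hG.total, cliqueSum, ← Nat.cast_sum,
      ENNReal.toReal_natCast, Nat.cast_sum]
  rw [expect, tsum_eq_sum (s := nCliques N G.weight), Finset.sum_div]
  · refine Finset.sum_congr rfl fun A hA => ?_
    rw [State.preferential, PMF.normalize_apply, hval A hA, ENNReal.toReal_mul, ENNReal.toReal_inv,
      htot, ENNReal.toReal_natCast]
    ring
  · intro A hA
    rw [State.preferential, PMF.normalize_apply, hzero A hA]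
    simp

theorem expect_uniform (G : State N) (m : ℕ) (hm : m ≤ N) (g : Finset ℕ → ℝ) :
    expect (G.uniform m hm) g =
      (∑ A ∈ Finset.powersetCard m (Finset.range G.order), g A) / G.order.choose m := by
  rw [expect, tsum_eq_sum (s := Finset.powersetCard m (Finset.range G.order)), Finset.sum_div]
  · refine Finset.sum_congr rfl fun A hA => ?_
    rw [State.uniform, PMF.uniformOfFinset_apply_of_mem _ hA, ENNReal.toReal_inv,
      ENNReal.toReal_natCast, Finset.card_powersetCard, Finset.card_range]
    ring
  · intro A hA
    rw [State.uniform, PMF.uniformOfFinset_apply_of_notMem _ hA]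
    simp

/-- The conditional expectation of a bounded quantity that is constant when a vertex is added. -/
theorem WellFormed.expect_step {n : ℕ} {G : State N} (hG : WellFormed n G) (hN : 3 ≤ N)
    (p q r : unitInterval) {F : State N → ℝ} {C : ℝ} (hF : ∀ s, |F s| ≤ C) {c : ℝ}
    {g : Finset ℕ → ℝ}
    (hnew : ∀ A : Finset ℕ, A.card = N - 1 → A ⊆ Finset.range G.order → F (G.interactNew A) = c)
    (hold : ∀ A : Finset ℕ, A.card = N → A ⊆ Finset.range G.order → F (G.interactOld A) = g A) :
    expect (step hN p q r G) F = p * c + (1 - p) *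
      (q * ((∑ A ∈ nCliques N G.weight, (G.weight A : ℝ) * g A) / (n + 1)) +
        (1 - q) * ((∑ A ∈ Finset.powersetCard N (Finset.range G.order), g A) /
          G.order.choose N)) := by
  rw [NInteractions.step, expect_mixture _ _ _ hF, expect_map _ _ hF, expect_map _ _ hF,
    expect_mixture (F := F ∘ G.interactOld) q _ _ fun A => hF (G.interactOld A)]
  -- The integrand is constant on the support of the new-vertex branch, so `r` drops out.
  have e1 : expect (mixture r (G.preferential (N - 1) (by omega) (by omega))
      (G.uniform (N - 1) (by omega))) (F ∘ G.interactNew) = c := by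
    rw [expect_congr (F' := fun _ => c), expect_const]
    intro A hA
    obtain ⟨h1, h2⟩ := hG.of_mem_support_choice hA
    exact hnew A h1 h2
  rw [e1, expect_congr (P := G.preferential N _ _) (F' := g),
    expect_congr (P := G.uniform N _) (F' := g), hG.expect_preferential, expect_uniform]
  · intro A hA
    obtain ⟨h1, h2⟩ := of_mem_support_uniform hA
    exact hold A h1 h2
  · intro A hA
    obtain ⟨h1, h2⟩ := hG.of_mem_support_preferential hA
    exact hold A h1 h2

/-- The increment of `f`, discarded when it exceeds one in absolute value. -/
noncomputable def boundedIncrement {S : Type*} (f : S → ℝ) (s t : S) : ℝ :=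
  if |f t - f s| ≤ 1 then f t - f s else 0

/-- The law for innovations needs a bound over all pairs of states, reachable or not; truncation
supplies it without altering increments of size at most one. -/
theorem abs_boundedIncrement_le {S : Type*} (f : S → ℝ) (s t : S) :
    |boundedIncrement f s t| ≤ 1 := by
  rw [boundedIncrement]
  split_ifs with h
  · exact h
  · simp

theorem boundedIncrement_eq {S : Type*} {f : S → ℝ} {s t : S} {d : ℝ} (h : f t = f s + d)
    (hd : |d| ≤ 1) : boundedIncrement f s t = d := by
  have : f t - f s = d := by rw [h]; ring
  rw [boundedIncrement, this, if_pos hd]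

/-- The change of the number of cliques of weight `w` when a clique of weight `v` gains one. -/
def countChange (w v : ℕ) : ℝ := (if v + 1 = w then 1 else 0) - if v = w then 1 else 0

theorem abs_countChange_le (w v : ℕ) : |countChange w v| ≤ 1 := by
  rw [countChange]
  split_ifs <;> first | omega | norm_num

theorem cliqueCount_interactOld (G : State N) (hN : 1 ≤ N) {w : ℕ} (hw : 1 ≤ w) {A : Finset ℕ}
    (hA : A.card = N) : ((G.interactOld A).cliqueCount w : ℝ) =
      G.cliqueCount w + countChange w (G.weight A) := by
  rw [cliqueCount_eq_cliqueSum, cliqueCount_eq_cliqueSum, State.interactOld,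
    cliqueSum_add_increment hN _ hA (if_neg (by omega))]
  rfl

theorem WellFormed.cliqueCount_interactNew {n : ℕ} {G : State N} (hG : WellFormed n G)
    (hN : 1 ≤ N) {w : ℕ} (hw : 1 ≤ w) {A : Finset ℕ} (hA : A.card = N - 1)
    (hs : A ⊆ Finset.range G.order) : ((G.interactNew A).cliqueCount w : ℝ) =
      G.cliqueCount w + countChange w 0 := by
  rw [cliqueCount_eq_cliqueSum, cliqueCount_eq_cliqueSum, State.interactNew,
    cliqueSum_add_increment hN _ (card_insert_order hN hA hs) (if_neg (by omega)),
    hG.weight_insert_order]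
  rfl

theorem WellFormed.abs_order_increment {n : ℕ} {G s : State N} (hG : WellFormed n G)
    {hN : 3 ≤ N} {p q r : unitInterval} (hs : s ∈ (step hN p q r G).support) :
    |(s.order : ℝ) - G.order| ≤ 1 := by
  obtain ⟨A, -, rfl⟩ | ⟨A, -, rfl⟩ := hG.of_mem_support_step hs
  · simp [State.interactNew]
  · simp [State.interactOld]

theorem WellFormed.abs_cliqueCount_increment {n : ℕ} {G s : State N} (hG : WellFormed n G)
    {hN : 3 ≤ N} {p q r : unitInterval} {w : ℕ} (hw : 1 ≤ w)
    (hs : s ∈ (step hN p q r G).support) :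
    |(s.cliqueCount w : ℝ) - G.cliqueCount w| ≤ 1 := by
  obtain ⟨A, hA, rfl⟩ | ⟨A, hA, rfl⟩ := hG.of_mem_support_step hs
  · rw [hG.cliqueCount_interactNew (by omega) hw hA.1 hA.2, add_sub_cancel_left]
    exact abs_countChange_le _ _
  · rw [cliqueCount_interactOld G (by omega) hw hA.1, add_sub_cancel_left]
    exact abs_countChange_le _ _

theorem WellFormed.expect_order_increment {n : ℕ} {G : State N} (hG : WellFormed n G)
    (hN : 3 ≤ N) (p q r : unitInterval) :
    expect (step hN p q r G) (boundedIncrement (fun s => (s.order : ℝ)) G) = p := by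
  rw [hG.expect_step hN p q r (abs_boundedIncrement_le _ G) (c := 1) (g := fun _ => 0)]
  · simp
  · intro A _ _
    exact boundedIncrement_eq (by simp [State.interactNew]) (by simp)
  · intro A _ _
    exact boundedIncrement_eq (by simp [State.interactOld]) (by simp)

/-- The fraction by which a uniformly chosen set of old vertices changes the number of cliques of
weight `w` on average. -/
noncomputable def uniformDrift (w : ℕ) (G : State N) : ℝ :=
  (∑ A ∈ Finset.powersetCard N (Finset.range G.order), countChange w (G.weight A)) /
    G.order.choose N

/-- Weight `w` is gained from cliques of weight `w - 1` and lost from those of weight `w`. The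
grouping isolates the term proportional to the current count, as the recursion lemma requires. -/
theorem WellFormed.expect_cliqueCount_increment {n : ℕ} {G : State N} (hG : WellFormed n G)
    (hN : 3 ≤ N) (p q r : unitInterval) {w : ℕ} (hw : 1 ≤ w) :
    expect (step hN p q r G) (boundedIncrement (fun s => (s.cliqueCount w : ℝ)) G) =
      (p * countChange w 0 + (1 - p) * (q * ((w - 1) * (G.cliqueCount (w - 1) / (n + 1))) +
        (1 - q) * uniformDrift w G)) - (1 - p) * q * w * (G.cliqueCount w / (n + 1)) := by
  rw [hG.expect_step hN p q r (abs_boundedIncrement_le _ G) (c := countChange w 0)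
    (g := fun A => countChange w (G.weight A))]
  · have h1 := cliqueSum_mul_indicator G (w - 1)
    have h2 := cliqueSum_mul_indicator G w
    rw [Nat.cast_sub hw, Nat.cast_one] at h1
    have h3 : ∑ A ∈ nCliques N G.weight, (G.weight A : ℝ) * countChange w (G.weight A) =
        (w - 1) * G.cliqueCount (w - 1) - w * G.cliqueCount w := by
      rw [← h1, ← h2, cliqueSum, cliqueSum, ← Finset.sum_sub_distrib]
      refine Finset.sum_congr rfl fun A _ => ?_
      have : G.weight A + 1 = w ↔ G.weight A = w - 1 := by omega
      rw [countChange, if_congr this rfl rfl, mul_sub]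
    rw [h3, uniformDrift]
    ring
  · intro A hA hs
    exact boundedIncrement_eq (hG.cliqueCount_interactNew (by omega) hw hA hs)
      (abs_countChange_le _ _)
  · intro A hA _
    exact boundedIncrement_eq (cliqueCount_interactOld G (by omega) hw hA) (abs_countChange_le _ _)

/-! ### Uniform choices rarely meet an existing clique -/

theorem WellFormed.card_nCliques_le {n : ℕ} {G : State N} (hG : WellFormed n G) :
    ((nCliques N G.weight).card : ℝ) ≤ n + 1 := by
  rw [← hG.total, cliqueSum, Finset.card_eq_sum_ones, Nat.cast_sum]
  refine Finset.sum_le_sum fun A hA => ?_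
  have : G.weight A ≠ 0 := Finsupp.mem_support_iff.1 (Finset.mem_filter.1 hA).1
  exact_mod_cast Nat.one_le_iff_ne_zero.2 this

/-- Only sets of positive weight deviate from the value at weight zero: at most `n + 1` sets, each
by at most `2`. -/
theorem WellFormed.abs_uniformDrift_sub_le {n : ℕ} {G : State N} (hG : WellFormed n G) (w : ℕ) :
    |uniformDrift w G - countChange w 0| ≤ 2 * (n + 1) / G.order.choose N := by
  have hpos : (0 : ℝ) < G.order.choose N := by exact_mod_cast Nat.choose_pos G.le_order
  have hsub : nCliques N G.weight ⊆ Finset.powersetCard N (Finset.range G.order) := fun A hA => by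
    obtain ⟨h1, h2⟩ := Finset.mem_filter.1 hA
    exact Finset.mem_powersetCard.2 ⟨hG.subset_range A h1, h2⟩
  have h1 : uniformDrift w G - countChange w 0 =
      (∑ A ∈ nCliques N G.weight, (countChange w (G.weight A) - countChange w 0)) /
        G.order.choose N := by
    rw [uniformDrift, Finset.sum_subset hsub, Finset.sum_sub_distrib]
    · simp only [Finset.sum_const, Finset.card_powersetCard, Finset.card_range, nsmul_eq_mul]
      field_simp
    · intro A hA hA'
      have : G.weight A = 0 := by
        by_contra h
        exact hA' (Finset.mem_filter.2
          ⟨Finsupp.mem_support_iff.2 h, (Finset.mem_powersetCard.1 hA).2⟩)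
      rw [this, sub_self]
  rw [h1, abs_div, Nat.abs_cast]
  refine div_le_div_of_nonneg_right ?_ hpos.le
  calc _ ≤ ∑ A ∈ nCliques N G.weight, (2 : ℝ) :=
        (Finset.abs_sum_le_sum_abs _ _).trans (Finset.sum_le_sum fun A _ =>
          (abs_sub _ _).trans ((add_le_add (abs_countChange_le w (G.weight A))
            (abs_countChange_le w 0)).trans_eq one_add_one_eq_two))
    _ ≤ 2 * (n + 1) := by
        rw [Finset.sum_const, nsmul_eq_mul, mul_comm]
        linarith [hG.card_nCliques_le]

theorem tendsto_div_choose (hN : 2 ≤ N) {V : ℕ → ℕ} {p : ℝ} (hp : 0 < p)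
    (hV : Tendsto (fun n : ℕ => (V n : ℝ) / n) atTop (𝓝 p)) :
    Tendsto (fun n : ℕ => 2 * ((n : ℝ) + 1) / (V n).choose N) atTop (𝓝 0) := by
  set c := p / 2 with hc
  have hcpos : 0 < c := by positivity
  have hlim : Tendsto (fun n : ℕ => 2 * (N.factorial : ℝ) / c ^ 2 * (1 / ((n : ℝ) + 1))) atTop
      (𝓝 0) := by
    simpa using (tendsto_one_div_add_atTop_nhds_zero_nat (𝕜 := ℝ)).const_mul
      (2 * (N.factorial : ℝ) / c ^ 2)
  -- Taking half the limiting slope leaves room for the shift by `N` in the lower bound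
  -- `Nat.pow_le_choose`.
  have hW : ∀ᶠ n : ℕ in atTop, c * ((n : ℝ) + 1) ≤ V n + 1 - N := by
    have h1 : Tendsto (fun n : ℕ => (V n : ℝ) / n - (c + N) / n) atTop (𝓝 (p - 0)) :=
      hV.sub (tendsto_const_div_atTop_nhds_zero_nat _)
    filter_upwards [h1.eventually_const_lt (u := c) (by rw [hc]; linarith),
      eventually_gt_atTop 0] with n hn hn0
    have : (0 : ℝ) < n := by exact_mod_cast hn0
    rw [← sub_div, lt_div_iff₀ this] at hn
    linarith
  have hone : ∀ᶠ n : ℕ in atTop, 1 ≤ c * ((n : ℝ) + 1) := by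
    filter_upwards [eventually_ge_atTop ⌈c⁻¹⌉₊] with n hn
    have h2 : c⁻¹ ≤ n := (Nat.le_ceil _).trans (by exact_mod_cast hn)
    have h3 : c * c⁻¹ ≤ c * ((n : ℝ) + 1) := by gcongr; linarith
    rwa [mul_inv_cancel₀ hcpos.ne'] at h3
  refine squeeze_zero' (Eventually.of_forall fun n => by positivity) ?_ hlim
  filter_upwards [hW, hone] with n h1 h2
  have hpow : (c * ((n : ℝ) + 1)) ^ 2 / N.factorial ≤ (V n).choose N := by
    refine le_trans ?_ (Nat.pow_le_choose N (V n))
    gcongr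
    -- The base is at least one, so the exponent `N` may be lowered to `2`, which already beats the
    -- linear numerator.
    refine (pow_le_pow_right₀ h2 hN).trans (pow_le_pow_left₀ (by positivity) (h1.trans ?_) N)
    rw [sub_le_iff_le_add]
    exact_mod_cast (le_tsub_add : V n + 1 ≤ V n + 1 - N + N)
  have hfac : (0 : ℝ) < N.factorial := by positivity
  calc 2 * ((n : ℝ) + 1) / (V n).choose N
      ≤ 2 * ((n : ℝ) + 1) / ((c * ((n : ℝ) + 1)) ^ 2 / N.factorial) := by gcongr
    _ = 2 * (N.factorial : ℝ) / c ^ 2 * (1 / ((n : ℝ) + 1)) := by field_simp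

/-! ### Almost sure limits for the model -/

section Realisation

variable {hN : 3 ≤ N} {p q r : unitInterval} {Ω : Type*} [MeasurableSpace Ω] {μ : Measure Ω}
  {G : ℕ → Ω → State N}

theorem IsNInteractionsProcess.isChain (hG : IsNInteractionsProcess hN p q r μ G) :
    IsChain (step hN p q r) μ G :=
  ⟨hG.measurable, hG.transition⟩

variable [IsProbabilityMeasure μ]

/-- Almost surely, all transitions are possible ones and all states are well formed. -/
theorem IsNInteractionsProcess.ae_regular (hG : IsNInteractionsProcess hN p q r μ G) :
    ∀ᵐ ω ∂μ, ∀ n, WellFormed n (G n ω) ∧ G (n + 1) ω ∈ (step hN p q r (G n ω)).support := by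
  filter_upwards [hG.initial, hG.isChain.ae_transition_ne_zero] with ω h0 hstep
  have hs : ∀ n, G (n + 1) ω ∈ (step hN p q r (G n ω)).support := fun n =>
    (PMF.mem_support_iff _ _).2 (hstep n)
  refine fun n => ⟨?_, hs n⟩
  induction n with
  | zero => rw [h0]; exact wellFormed_initialState (by omega)
  | succ n ih => exact ih.next (hs n)

/-- If the conditional expectation of the increments of a statistic is `β n - a * X n / (n + 1)`
with `β n` convergent, then the statistic grows linearly. -/
theorem IsNInteractionsProcess.ae_tendsto_statistic (hG : IsNInteractionsProcess hN p q r μ G)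
    {f : State N → ℝ} (hf : ∀ n (g s : State N), WellFormed n g →
      s ∈ (step hN p q r g).support → |f s - f g| ≤ 1) {a b : ℝ} (ha : 0 ≤ a) {β : ℕ → Ω → ℝ}
    (hβ : ∀ᵐ ω ∂μ, Tendsto (fun n => β n ω) atTop (𝓝 b))
    (hdrift : ∀ n ω, WellFormed n (G n ω) → expect (step hN p q r (G n ω))
      (boundedIncrement f (G n ω)) = β n ω - a * (f (G n ω) / (n + 1))) :
    ∀ᵐ ω ∂μ, Tendsto (fun n : ℕ => f (G n ω) / n) atTop (𝓝 (b / (1 + a))) := by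
  filter_upwards [hG.ae_regular, hβ,
    hG.isChain.ae_tendsto_average_innovation (abs_boundedIncrement_le f)] with ω hreg hβω hS
  -- The noise `S` is the accumulated innovation; on possible transitions between well-formed states
  -- the truncation is inactive.
  refine tendsto_div_of_recursion (X := fun n => f (G n ω)) ha hβω hS fun n => ?_
  have h1 := hf n _ _ (hreg n).1 (hreg n).2
  rw [Finset.sum_range_succ, add_sub_cancel_left, hdrift n ω (hreg n).1, boundedIncrement,
    if_pos h1]
  ring

theorem IsNInteractionsProcess.ae_tendsto_order (hG : IsNInteractionsProcess hN p q r μ G) :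
    ∀ᵐ ω ∂μ, Tendsto (fun n : ℕ => ((G n ω).order : ℝ) / n) atTop (𝓝 p) := by
  have := hG.ae_tendsto_statistic (f := fun s => (s.order : ℝ)) (a := 0) (b := p)
    (β := fun _ _ => p) (fun n g s hg hs => hg.abs_order_increment hs) le_rfl
    (ae_of_all _ fun _ => tendsto_const_nhds) fun n ω hω => by
      rw [hω.expect_order_increment hN p q r]; ring
  simpa using this

theorem IsNInteractionsProcess.ae_tendsto_uniformDrift
    (hG : IsNInteractionsProcess hN p q r μ G) (hp : 0 < (p : ℝ)) (w : ℕ) :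
    ∀ᵐ ω ∂μ, Tendsto (fun n => uniformDrift w (G n ω)) atTop (𝓝 (countChange w 0)) := by
  filter_upwards [hG.ae_regular, hG.ae_tendsto_order] with ω hreg hV
  rw [tendsto_iff_norm_sub_tendsto_zero]
  exact squeeze_zero (fun _ => norm_nonneg _) (fun n => (hreg n).1.abs_uniformDrift_sub_le w)
    (tendsto_div_choose (by omega) hp hV)

/-- The inductive step: the asymptotics of the number of cliques of weight `w - 1` determine those
of the number of cliques of weight `w`. -/
theorem IsNInteractionsProcess.ae_tendsto_cliqueCount
    (hG : IsNInteractionsProcess hN p q r μ G) (hp : 0 < (p : ℝ)) {w : ℕ} (hw : 1 ≤ w) {x : ℝ}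
    (hx : ∀ᵐ ω ∂μ, Tendsto (fun n : ℕ => ((w : ℝ) - 1) *
      (((G n ω).cliqueCount (w - 1) : ℝ) / n)) atTop (𝓝 x)) :
    ∀ᵐ ω ∂μ, Tendsto (fun n : ℕ => ((G n ω).cliqueCount w : ℝ) / n) atTop
      (𝓝 ((p * countChange w 0 + (1 - p) * (q * x + (1 - q) * countChange w 0)) /
        (1 + (1 - p) * q * w))) := by
  have hp1 : 0 ≤ 1 - (p : ℝ) := sub_nonneg.2 p.2.2
  refine hG.ae_tendsto_statistic (f := fun s => (s.cliqueCount w : ℝ))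
    (a := (1 - p) * q * w)
    (β := fun n ω => p * countChange w 0 + (1 - p) *
      (q * ((w - 1) * ((G n ω).cliqueCount (w - 1) / (n + 1))) +
        (1 - q) * uniformDrift w (G n ω)))
    (fun n g s hg hs => hg.abs_cliqueCount_increment hw hs)
    (mul_nonneg (mul_nonneg hp1 q.2.1) (Nat.cast_nonneg w)) ?_
    fun n ω hω => hω.expect_cliqueCount_increment hN p q r hw
  filter_upwards [hx, hG.ae_tendsto_uniformDrift hp w] with ω h1 h2
  have h3 : Tendsto (fun n : ℕ => ((w : ℝ) - 1) *
      (((G n ω).cliqueCount (w - 1) : ℝ) / (n + 1))) atTop (𝓝 x) := by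
    have := h1.mul (tendsto_natCast_div_add_atTop (1 : ℝ))
    rw [mul_one] at this
    refine this.congr' ?_
    filter_upwards [eventually_ne_atTop 0] with n hn
    have : (n : ℝ) ≠ 0 := by exact_mod_cast hn
    field_simp
  exact (((h3.const_mul _).add (h2.const_mul _)).const_mul _).const_add _

end Realisation

/-! ### Identification of the limits -/

/-- The limiting frequencies of the cliques of weight `w`. -/
noncomputable def limitFrequency (h : ℝ) : ℕ → ℝ
  | 0 => 0
  | 1 => (1 - h) / (h + 1)
  | w + 2 => (((w + 2 : ℕ) : ℝ) - 1) * h / (((w + 2 : ℕ) : ℝ) * h + 1) * limitFrequency h (w + 1)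

theorem limitFrequency_nonneg {h : ℝ} (h0 : 0 ≤ h) (h1 : h ≤ 1) (w : ℕ) :
    0 ≤ limitFrequency h (w + 1) := by
  induction w with
  | zero => exact div_nonneg (sub_nonneg.2 h1) (by positivity)
  | succ w ih =>
    rw [limitFrequency]
    refine mul_nonneg (div_nonneg (mul_nonneg ?_ h0) (by positivity)) ih
    push_cast
    linarith [(Nat.cast_nonneg w : (0 : ℝ) ≤ w)]

end NInteractions

open NInteractions in
theorem mainTheorem5 (N : ℕ) (hN : 3 ≤ N) (p q r : unitInterval)
    (hp₀ : 0 < (p : ℝ)) (hp₁ : (p : ℝ) < 1) (hq : 0 < (q : ℝ))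
    (h : ℝ) (hh : h = (1 - (p : ℝ)) * (q : ℝ)) :
    ∃ k : ℕ → ℝ,
      (∀ w : ℕ, 1 ≤ w → 0 ≤ k w) ∧
      k 1 = (1 - h) / (h + 1) ∧
      (∀ w : ℕ, 1 < w → k w = (((w : ℝ) - 1) * h) / ((w : ℝ) * h + 1) * k (w - 1)) ∧
      ∀ (Ω : Type*) [MeasurableSpace Ω] (μ : Measure Ω) [IsProbabilityMeasure μ]
        (G : ℕ → Ω → NInteractions.State N),
        NInteractions.IsNInteractionsProcess hN p q r μ G →
        ∀ w : ℕ, 1 ≤ w →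
          ∀ᵐ ω ∂μ, Tendsto (fun n : ℕ => ((G n ω).cliqueCount w : ℝ) / (n : ℝ))
            atTop (𝓝 (k w)) := by
  have h0 : 0 ≤ h := by rw [hh]; exact mul_nonneg (sub_nonneg.2 hp₁.le) hq.le
  have h1 : h ≤ 1 := by rw [hh]; nlinarith [q.2.2]
  refine ⟨limitFrequency h, ?_, rfl, ?_, ?_⟩
  · intro w hw
    obtain ⟨v, rfl⟩ := Nat.exists_eq_add_of_le' hw
    exact limitFrequency_nonneg h0 h1 v
  · intro w hw
    obtain ⟨v, rfl⟩ := Nat.exists_eq_add_of_le' hw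
    rfl
  · intro Ω _ μ _ G hG w hw
    induction w, hw using Nat.le_induction with
    -- The factor `w - 1` vanishes, so `x = 0`; new sets contribute `p + (1 - p) * (1 - q) = 1 - h`.
    | base =>
      have := hG.ae_tendsto_cliqueCount hp₀ le_rfl (x := 0) (ae_of_all _ fun ω => by simp)
      convert this using 5
      simp only [limitFrequency, countChange, hh]
      norm_num
      congr 1 <;> ring
    -- At weight `w + 1 ≥ 2` a new clique contributes nothing, and only the gain `h * w *
    -- limitFrequency h w` survives in the numerator.
    | succ w hw ih =>
      have := hG.ae_tendsto_cliqueCount hp₀ (Nat.le_add_left 1 w) (x := w * limitFrequency h w)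
        (by filter_upwards [ih] with ω hω; simpa using hω.const_mul (w : ℝ))
      convert this using 5
      obtain ⟨v, rfl⟩ := Nat.exists_eq_add_of_le' hw
      simp only [limitFrequency, countChange, hh]
      rw [if_neg (by omega), if_neg (by omega)]
      push_cast
      ring
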